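/- **Theorem 2.** Let $p_0>0$, $p_1\ge 0$, $p_0+p_1=1$, $0<\eta\le 1$, $N_t>0$, $0<\tau\le 1$, $0<\xi\le 1$ and $\nu\ge 0$ be real numbers. For real $\beta,\gamma$ put $n_\pm=\tau(\beta^2+\gamma^2\pm 2\xi\beta\gamma)+\nu$, and for $K=0,1,2,\dots$ put $$P(K\mid\pm\beta,\gamma)=\frac{(\eta N_t)^K}{(\eta N_t+1)^{K+1}}\,\exp\!\Big(-\frac{n_\pm}{N_t+1/\eta}\Big)\,L_K\!\Big(-\frac{n_\pm}{N_t(\eta N_t+1)}\Big),$$ where $L_K$ is the Laguerre polynomial of order $K$. (This is the probability that a photon-number-resolving detector of quantum efficiency $\eta$ detects $K$ photons when the coherent state $|\pm\beta\rangle$, displaced by $\gamma$ through a beam splitter of transmittance $\tau$ with interference visibility $\xi$, is received with $N_t$ thermal photons and mean dark count number $\nu$.) For an integer threshold $K_{th}\ge 0$ let $$P_e(K_{th},\gamma)=p_0\sum_{K=K_{th}+1}^{\infty}P(K\mid-\beta,\gamma)+p_1\sum_{K=0}^{K_{th}}P(K\mid\beta,\gamma)$$ be the error probability of threshold detection, and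 call $\gamma^*\in\mathbb{R}$ an optimum displacement for $\beta$ if it minimises $\gamma\mapsto P_e(K_{th},\gamma)$ over $\mathbb{R}$. Fix any integer $K_{th}\ge 0$. Then an optimum displacement exists for all sufficiently large $\beta$, and for every choice of an optimum displacement $\gamma^*=\gamma^*(\beta)$ for all sufficiently large $\beta$, $$\gamma^*(\beta)-\xi\beta\to 0\qquad\text{as }\beta\to+\infty .$$ -/

import Mathlib

open Filter Topology

namespace KennedyReceiver

noncomputable section

/-- The Laguerre polynomial `L_m`, evaluated at the real number `x`. -/
def laguerre (m : ℕ) (x : ℝ) : ℝ :=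
  ∑ k ∈ Finset.range (m + 1), (m.choose k : ℝ) * (-1) ^ k / (k.factorial : ℝ) * x ^ k

/-- Mean photon number (signal plus dark counts) after displacing the coherent state of real
amplitude `b` by the real displacement `γ`: transmittance `τ`, interference visibility `ξ`, mean
dark count number `ν`.  The two hypotheses correspond to `b = β` and `b = -β`. -/
def meanPhotons (τ ξ ν b γ : ℝ) : ℝ :=
  τ * (b ^ 2 + γ ^ 2 + 2 * ξ * b * γ) + ν

/-- `P(K | b, γ)`: the probability that a photon number resolving detector of quantum efficiency
`η` detects `K` photons when the coherent state of amplitude `b` was transmitted and displaced by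
`γ`, in the presence of `Nt` thermal photons. -/
def detectProb (η Nt τ ξ ν : ℝ) (K : ℕ) (b γ : ℝ) : ℝ :=
  (η * Nt) ^ K / (η * Nt + 1) ^ (K + 1)
    * Real.exp (-(meanPhotons τ ξ ν b γ / (Nt + 1 / η)))
    * laguerre K (-(meanPhotons τ ξ ν b γ / (Nt * (η * Nt + 1))))

/-- The error probability `P_e(Kth, γ)` of threshold detection, with prior probabilities `p₀` of
`-β` and `p₁` of `β`: the receiver decides for `-β` if `K ≤ Kth` photons are detected, and for `β`
if `K > Kth`. -/
def errorProb (p₀ p₁ η Nt τ ξ ν β : ℝ) (Kth : ℕ) (γ : ℝ) : ℝ :=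
  p₀ * ∑' i : ℕ, detectProb η Nt τ ξ ν (Kth + 1 + i) (-β) γ
    + p₁ * ∑ K ∈ Finset.range (Kth + 1), detectProb η Nt τ ξ ν K β γ

/-- `γ` is an optimum displacement for the threshold `Kth`: it minimises `P_e(Kth, ·)` over all
real displacements. -/
def IsOptimumDisplacement (p₀ p₁ η Nt τ ξ ν β : ℝ) (Kth : ℕ) (γ : ℝ) : Prop :=
  ∀ γ' : ℝ, errorProb p₀ p₁ η Nt τ ξ ν β Kth γ ≤ errorProb p₀ p₁ η Nt τ ξ ν β Kth γ'

end

end KennedyReceiver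

namespace KennedyReceiver

/-! Let `F` be the distribution function of the count at `Kth`, as a function of the normalised
intensity `y`. Then `P_e = p₀ (1 - F y₋) + p₁ F y₊`, and `y₋ = A + c τ (γ - ξ β)²` is least at `γ =
ξ β`. Since `A` may grow with `β`, `F A` may tend to 0, so a relative decay estimate is needed: `F
(y + s) ≤ exp (-κ s) F y` (`photonCdf_add_le`). A displacement at distance at least `ε` from `ξ β`
raises the first term by at least `p₀ F A (1 - exp (-κ c τ ε²))`, while the second term at `ξ β` is
at most `p₁ F A exp (-4 κ c τ ξ² β²)`. The factor `F A` cancels, and the gain is negligible for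
large `β`. -/

/-- Photon number distribution of displaced thermal light with mean thermal photon number `a`
and normalised signal intensity `y`. -/
noncomputable def photonProb (a : ℝ) (K : ℕ) (y : ℝ) : ℝ :=
  a ^ K / (a + 1) ^ (K + 1) * Real.exp (-y) * laguerre K (-(y / a))

/-- Distribution function of `photonProb`. -/
noncomputable def photonCdf (a : ℝ) (N : ℕ) (y : ℝ) : ℝ :=
  ∑ K ∈ Finset.range (N + 1), photonProb a K y

theorem detectProb_eq_photonProb {η Nt : ℝ} (hη : 0 < η) (hNt : 0 < Nt) (τ ξ ν : ℝ) (K : ℕ)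
    (b γ : ℝ) :
    detectProb η Nt τ ξ ν K b γ =
      photonProb (η * Nt) K (η / (η * Nt + 1) * meanPhotons τ ξ ν b γ) := by
  have h : 0 < η * Nt + 1 := by positivity
  have h1 : meanPhotons τ ξ ν b γ / (Nt + 1 / η)
      = η / (η * Nt + 1) * meanPhotons τ ξ ν b γ := by
    field_simp
  have h2 : meanPhotons τ ξ ν b γ / (Nt * (η * Nt + 1))
      = η / (η * Nt + 1) * meanPhotons τ ξ ν b γ / (η * Nt) := by
    field_simp
  rw [detectProb, photonProb, h1, h2]

/-! ### Laguerre polynomials -/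

theorem laguerre_neg (m : ℕ) (z : ℝ) :
    laguerre m (-z) = ∑ k ∈ Finset.range (m + 1), (m.choose k : ℝ) / (k.factorial : ℝ) * z ^ k := by
  refine Finset.sum_congr rfl fun k _ => ?_
  have h : ((-1 : ℝ)) ^ k * (-1) ^ k = 1 := by rw [← mul_pow]; simp
  rw [neg_pow z k]
  linear_combination ((m.choose k : ℝ) / (k.factorial : ℝ) * z ^ k) * h

theorem laguerre_neg_nonneg (m : ℕ) {z : ℝ} (hz : 0 ≤ z) : 0 ≤ laguerre m (-z) := by
  rw [laguerre_neg]
  positivity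

theorem laguerre_zero (x : ℝ) : laguerre 0 x = 1 := by simp [laguerre]

/-- The terms of `laguerre m` may be summed over any range beyond the degree. -/
theorem laguerre_eq_sum_range {m M : ℕ} (h : m + 1 ≤ M) (x : ℝ) :
    laguerre m x =
      ∑ k ∈ Finset.range M, (m.choose k : ℝ) * (-1) ^ k / (k.factorial : ℝ) * x ^ k := by
  refine Finset.sum_subset (Finset.range_mono h) fun k _ hk => ?_
  rw [Finset.mem_range, not_lt] at hk
  rw [Nat.choose_eq_zero_of_lt (by omega)]
  simp

/-- By Pascal's rule the difference has the coefficients of `laguerre m`, shifted by one degree. -/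
theorem hasDerivAt_laguerre_sub (m : ℕ) (x : ℝ) :
    HasDerivAt (fun x => laguerre (m + 1) x - laguerre m x) (-laguerre m x) x := by
  have h : (fun x => laguerre (m + 1) x - laguerre m x) = fun x : ℝ =>
      ∑ k ∈ Finset.range (m + 1),
        (m.choose k : ℝ) * (-1) ^ (k + 1) / ((k + 1).factorial : ℝ) * x ^ (k + 1) := by
    funext x
    rw [laguerre_eq_sum_range (le_refl (m + 1 + 1)),
      laguerre_eq_sum_range (show m + 1 ≤ m + 1 + 1 by omega), ← Finset.sum_sub_distrib,
      Finset.sum_range_succ']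
    simp only [Nat.choose_zero_right, sub_self, add_zero]
    refine Finset.sum_congr rfl fun k _ => ?_
    rw [Nat.choose_succ_succ]
    push_cast
    ring
  rw [h]
  have hd : HasDerivAt (fun x : ℝ => ∑ k ∈ Finset.range (m + 1),
      (m.choose k : ℝ) * (-1) ^ (k + 1) / ((k + 1).factorial : ℝ) * x ^ (k + 1))
      (∑ k ∈ Finset.range (m + 1),
        (m.choose k : ℝ) * (-1) ^ (k + 1) / ((k + 1).factorial : ℝ)
          * (((k + 1 : ℕ) : ℝ) * x ^ k)) x :=
    HasDerivAt.fun_sum fun k _ => (hasDerivAt_pow (k + 1) x).const_mul _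
  refine hd.congr_deriv (Eq.symm ?_)
  rw [laguerre, ← Finset.sum_neg_distrib]
  refine Finset.sum_congr rfl fun k _ => ?_
  rw [Nat.factorial_succ]
  push_cast
  have h1 : (k.factorial : ℝ) ≠ 0 := by positivity
  have h2 : (k : ℝ) + 1 ≠ 0 := by positivity
  field_simp
  ring

/-- `L_m' = -∑_{j < m} L_j`. -/
theorem hasDerivAt_laguerre (m : ℕ) (x : ℝ) :
    HasDerivAt (laguerre m) (-∑ j ∈ Finset.range m, laguerre j x) x := by
  induction m with
  | zero =>
    have h : laguerre 0 = fun _ => (1 : ℝ) := funext laguerre_zero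
    rw [h]
    simpa using hasDerivAt_const x (1 : ℝ)
  | succ m ih =>
    have h := (hasDerivAt_laguerre_sub m x).add ih
    rw [Finset.sum_range_succ, neg_add_rev]
    refine h.congr_of_eventuallyEq (Eventually.of_forall fun y => ?_)
    simp

/-! ### Derivative and decay of the distribution function -/

theorem photonProb_nonneg {a : ℝ} (ha : 0 < a) (K : ℕ) {y : ℝ} (hy : 0 ≤ y) :
    0 ≤ photonProb a K y := by
  have := laguerre_neg_nonneg K (div_nonneg hy ha.le)
  unfold photonProb
  positivity

theorem photonCdf_pos {a : ℝ} (ha : 0 < a) (N : ℕ) {y : ℝ} (hy : 0 ≤ y) :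
    0 < photonCdf a N y := by
  refine Finset.sum_pos' (fun K _ => photonProb_nonneg ha K hy) ⟨0, by simp, ?_⟩
  rw [photonProb, laguerre_zero]
  positivity

theorem hasDerivAt_photonProb {a : ℝ} (K : ℕ) (y : ℝ) :
    HasDerivAt (photonProb a K)
      (a ^ K / (a + 1) ^ (K + 1) * Real.exp (-y) *
        ((∑ j ∈ Finset.range K, laguerre j (-(y / a))) / a - laguerre K (-(y / a)))) y := by
  have h1 : HasDerivAt (fun y : ℝ => Real.exp (-y)) (Real.exp (-y) * -1) y :=
    (hasDerivAt_neg y).exp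
  have h2 : HasDerivAt (fun y : ℝ => -(y / a)) (-(1 / a)) y := ((hasDerivAt_id y).div_const a).neg
  have h3 := (h1.const_mul (a ^ K / (a + 1) ^ (K + 1))).mul
    ((hasDerivAt_laguerre K (-(y / a))).comp y h2)
  exact h3.congr_deriv (by simp only [Function.comp_apply]; ring)

/-- The sum telescopes: the weights `w N = a ^ N / (a + 1) ^ (N + 1)` satisfy `w N - w (N + 1) / a =
w (N + 1)`. -/
theorem hasDerivAt_photonCdf {a : ℝ} (ha : 0 < a) (N : ℕ) (y : ℝ) :
    HasDerivAt (photonCdf a N)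
      (-(a ^ N / (a + 1) ^ (N + 1) * Real.exp (-y) *
        ∑ j ∈ Finset.range (N + 1), laguerre j (-(y / a)))) y := by
  induction N with
  | zero =>
    have h : photonCdf a 0 = photonProb a 0 := by funext y; simp [photonCdf]
    rw [h]
    exact (hasDerivAt_photonProb 0 y).congr_deriv (by simp)
  | succ N ih =>
    have h : photonCdf a (N + 1) = fun y => photonCdf a N y + photonProb a (N + 1) y := by
      funext y; exact Finset.sum_range_succ _ _
    rw [h]
    refine (ih.add (hasDerivAt_photonProb (N + 1) y)).congr_deriv ?_
    rw [Finset.sum_range_succ _ (N + 1)]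
    have h1 : a + 1 ≠ 0 := by positivity
    field_simp
    ring

theorem continuous_photonCdf {a : ℝ} (ha : 0 < a) (N : ℕ) : Continuous (photonCdf a N) :=
  continuous_iff_continuousAt.2 fun y => (hasDerivAt_photonCdf ha N y).continuousAt

/-- The distribution function decays at least exponentially, at rate `(a / (a + 1)) ^ N`. -/
theorem photonCdf_add_le {a : ℝ} (ha : 0 < a) (N : ℕ) {y s : ℝ} (hy : 0 ≤ y) (hs : 0 ≤ s) :
    photonCdf a N (y + s) ≤ Real.exp (-((a / (a + 1)) ^ N * s)) * photonCdf a N y := by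
  -- In the derivative every Laguerre term carries the weight of index `N`; `κ` scales each weight
  -- in the distribution function to at most that one.
  set κ := (a / (a + 1)) ^ N with hκ
  have hder : ∀ x : ℝ, HasDerivAt (fun x => Real.exp (κ * x) * photonCdf a N x)
      (Real.exp (κ * x) * (κ * photonCdf a N x -
        (a ^ N / (a + 1) ^ (N + 1) * Real.exp (-x) *
          ∑ j ∈ Finset.range (N + 1), laguerre j (-(x / a))))) x := by
    intro x
    have h1 : HasDerivAt (fun x : ℝ => Real.exp (κ * x)) (Real.exp (κ * x) * κ) x := by
      simpa using ((hasDerivAt_id x).const_mul κ).exp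
    exact (h1.mul (hasDerivAt_photonCdf ha N x)).congr_deriv (by ring)
  have hanti : AntitoneOn (fun x => Real.exp (κ * x) * photonCdf a N x) (Set.Ici 0) := by
    refine antitoneOn_of_deriv_nonpos (convex_Ici 0)
      (fun x _ => (hder x).continuousAt.continuousWithinAt)
      (fun x _ => (hder x).differentiableAt.differentiableWithinAt) fun x hx => ?_
    rw [interior_Ici, Set.mem_Ioi] at hx
    rw [(hder x).deriv]
    refine mul_nonpos_of_nonneg_of_nonpos (Real.exp_nonneg _) (sub_nonpos.2 ?_)
    rw [photonCdf, Finset.mul_sum, Finset.mul_sum]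
    refine Finset.sum_le_sum fun j _ => ?_
    have hL := laguerre_neg_nonneg j (div_nonneg hx.le ha.le)
    have hq : (a / (a + 1)) ^ j ≤ 1 :=
      pow_le_one₀ (by positivity) ((div_le_one (by positivity)).2 (by linarith))
    have heq : κ * photonProb a j x = (a / (a + 1)) ^ j *
        (a ^ N / (a + 1) ^ (N + 1) * Real.exp (-x) * laguerre j (-(x / a))) := by
      rw [hκ, photonProb, div_pow, div_pow]
      field_simp
      ring
    rw [heq]
    exact mul_le_of_le_one_left (by positivity) hq
  have h := hanti (Set.mem_Ici.2 hy) (Set.mem_Ici.2 (add_nonneg hy hs)) (by linarith : y ≤ y + s)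
  simp only [mul_add, Real.exp_add] at h
  rw [Real.exp_neg, ← div_eq_inv_mul, le_div_iff₀ (Real.exp_pos _)]
  have hpos := Real.exp_pos (κ * y)
  refine le_of_mul_le_mul_left ?_ hpos
  linarith

/-! ### Normalisation of the photon distribution -/

/-- The generating function of the Laguerre polynomials, at a nonpositive argument. -/
theorem hasSum_pow_mul_laguerre {q z : ℝ} (hq₀ : 0 ≤ q) (hq₁ : q < 1) (hz : 0 ≤ z) :
    HasSum (fun K : ℕ => q ^ K * laguerre K (-z))
      (Real.exp (q * z / (1 - q)) / (1 - q)) := by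
  have h1q : 0 < 1 - q := by linarith
  -- A pair `(k, j)` stands for the degree `k` term of `laguerre (k + j)`. Rows are negative
  -- binomial series, antidiagonals give the claim; nonnegativity permits the rearrangement.
  set f : ℕ × ℕ → ℝ := fun p =>
    (q * z) ^ p.1 / (p.1.factorial : ℝ) * (((p.2 + p.1).choose p.1 : ℝ) * q ^ p.2) with hf
  have hf₀ : 0 ≤ f := fun p => by simp only [hf, Pi.zero_apply]; positivity
  have hrow : ∀ k, HasSum (fun j => f (k, j))
      ((q * z / (1 - q)) ^ k / (k.factorial : ℝ) * (1 / (1 - q))) := by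
    intro k
    have h := (hasSum_choose_mul_geometric_of_norm_lt_one k
      (r := q) (by rwa [Real.norm_of_nonneg hq₀])).mul_left ((q * z) ^ k / (k.factorial : ℝ))
    have he : (q * z / (1 - q)) ^ k / (k.factorial : ℝ) * (1 / (1 - q))
        = (q * z) ^ k / (k.factorial : ℝ) * (1 / (1 - q) ^ (k + 1)) := by
      rw [div_pow, pow_succ]
      field_simp
    rw [he]
    exact h
  have hexp : HasSum (fun k : ℕ => (q * z / (1 - q)) ^ k / (k.factorial : ℝ) * (1 / (1 - q)))
      (Real.exp (q * z / (1 - q)) / (1 - q)) := by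
    rw [div_eq_mul_one_div (Real.exp _)]
    refine HasSum.mul_right _ ?_
    rw [Real.exp_eq_exp_ℝ]
    exact NormedSpace.expSeries_div_hasSum_exp _
  have hsum : Summable f := by
    rw [summable_prod_of_nonneg hf₀]
    refine ⟨fun k => (hrow k).summable, ?_⟩
    simp only [(hrow _).tsum_eq]
    exact hexp.summable
  have htot : HasSum f (Real.exp (q * z / (1 - q)) / (1 - q)) := by
    have h := hsum.hasSum
    rwa [(h.prod_fiberwise hrow).unique hexp] at h
  have hanti := ((Finset.HasAntidiagonal.sigmaAntidiagonalEquivProd (A := ℕ)).hasSum_iff.2 htot).sigma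
    (fun K => hasSum_fintype _)
  refine hanti.congr_fun fun K => ?_
  rw [laguerre_neg, Finset.mul_sum]
  refine Eq.trans ?_ (Finset.sum_attach (Finset.HasAntidiagonal.antidiagonal K) f).symm
  rw [Finset.Nat.sum_antidiagonal_eq_sum_range_succ_mk]
  refine Finset.sum_congr rfl fun k hk => ?_
  have hk' : k ≤ K := Nat.lt_succ_iff.1 (Finset.mem_range.1 hk)
  simp only [hf]
  rw [Nat.sub_add_cancel hk', mul_pow]
  have hqK : q ^ K = q ^ k * q ^ (K - k) := by rw [← pow_add, Nat.add_sub_cancel' hk']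
  rw [hqK]
  ring

/-- The generating function at `q = a / (a + 1)`, `z = y / a` has exponent exactly `y`. -/
theorem hasSum_photonProb {a y : ℝ} (ha : 0 < a) (hy : 0 ≤ y) :
    HasSum (fun K => photonProb a K y) 1 := by
  have h1 : a / (a + 1) < 1 := (div_lt_one (by positivity)).2 (by linarith)
  have h := (hasSum_pow_mul_laguerre (div_nonneg ha.le (by positivity)) h1
    (div_nonneg hy ha.le)).mul_left (Real.exp (-y) / (a + 1))
  have h2 : 1 - a / (a + 1) = 1 / (a + 1) := by field_simp; ring
  have h3 : a / (a + 1) * (y / a) / (1 / (a + 1)) = y := by field_simp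
  have h4 : Real.exp (-y) / (a + 1) * (Real.exp y / (1 / (a + 1))) = 1 := by
    rw [Real.exp_neg]
    field_simp
  rw [h2, h3, h4] at h
  refine h.congr_fun fun K => ?_
  rw [photonProb, div_pow, pow_succ]
  field_simp

theorem tsum_photonProb_tail {a y : ℝ} (ha : 0 < a) (hy : 0 ≤ y) (N : ℕ) :
    ∑' i : ℕ, photonProb a (N + 1 + i) y = 1 - photonCdf a N y := by
  have h := hasSum_photonProb ha hy
  have h1 := h.summable.sum_add_tsum_nat_add (N + 1)
  rw [h.tsum_eq] at h1
  simp only [add_comm _ (N + 1)] at h1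
  rw [photonCdf]
  linarith

/-! ### Localisation of the optimum -/

theorem meanPhotons_nonneg {τ ξ ν : ℝ} (hτ : 0 ≤ τ) (hξ₀ : 0 ≤ ξ) (hξ₁ : ξ ≤ 1) (hν : 0 ≤ ν)
    (b γ : ℝ) : 0 ≤ meanPhotons τ ξ ν b γ := by
  have h : 0 ≤ (1 - ξ ^ 2) * b ^ 2 := mul_nonneg (by nlinarith) (sq_nonneg b)
  have h2 : 0 ≤ b ^ 2 + γ ^ 2 + 2 * ξ * b * γ := by nlinarith [sq_nonneg (γ + ξ * b)]
  unfold meanPhotons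
  positivity

section Optimum

variable {p₀ p₁ η Nt τ ξ ν : ℝ}

theorem errorProb_eq (hη : 0 < η) (hNt : 0 < Nt) (hτ : 0 ≤ τ) (hξ₀ : 0 ≤ ξ) (hξ₁ : ξ ≤ 1)
    (hν : 0 ≤ ν) (p₀ p₁ β : ℝ) (N : ℕ) (γ : ℝ) :
    errorProb p₀ p₁ η Nt τ ξ ν β N γ =
      p₀ * (1 - photonCdf (η * Nt) N (η / (η * Nt + 1) * meanPhotons τ ξ ν (-β) γ))
        + p₁ * photonCdf (η * Nt) N (η / (η * Nt + 1) * meanPhotons τ ξ ν β γ) := by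
  have ha : 0 < η * Nt := by positivity
  simp only [errorProb, detectProb_eq_photonProb hη hNt]
  rw [tsum_photonProb_tail ha
    (mul_nonneg (by positivity) (meanPhotons_nonneg hτ hξ₀ hξ₁ hν (-β) γ)), photonCdf, photonCdf]

theorem continuous_errorProb (hη : 0 < η) (hNt : 0 < Nt) (hτ : 0 ≤ τ) (hξ₀ : 0 ≤ ξ) (hξ₁ : ξ ≤ 1)
    (hν : 0 ≤ ν) (p₀ p₁ β : ℝ) (N : ℕ) :
    Continuous (errorProb p₀ p₁ η Nt τ ξ ν β N) := by
  have hc := continuous_photonCdf (mul_pos hη hNt) N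
  have hm : ∀ b, Continuous fun γ => η / (η * Nt + 1) * meanPhotons τ ξ ν b γ := fun b => by
    unfold meanPhotons
    fun_prop
  rw [funext (errorProb_eq hη hNt hτ hξ₀ hξ₁ hν p₀ p₁ β N)]
  exact (continuous_const.mul (continuous_const.sub (hc.comp (hm (-β))))).add
    (continuous_const.mul (hc.comp (hm β)))

/-- For large `β`, displacements at distance at least `ε` from `ξ * β` are worse than `ξ * β`. -/
theorem eventually_errorProb_lt (hp₀ : 0 < p₀) (hp₁ : 0 ≤ p₁) (hη : 0 < η) (hNt : 0 < Nt)
    (hτ : 0 < τ) (hξ₀ : 0 < ξ) (hξ₁ : ξ ≤ 1) (hν : 0 ≤ ν) (N : ℕ) {ε : ℝ} (hε : 0 < ε) :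
    ∀ᶠ β : ℝ in atTop, ∀ γ : ℝ, ε ≤ |γ - ξ * β| →
      errorProb p₀ p₁ η Nt τ ξ ν β N (ξ * β) < errorProb p₀ p₁ η Nt τ ξ ν β N γ := by
  have ha : 0 < η * Nt := by positivity
  set c := η / (η * Nt + 1) with hc
  have hc₀ : 0 < c := by positivity
  set κ := (η * Nt / (η * Nt + 1)) ^ N with hκ
  have hκ₀ : 0 < κ := by positivity
  -- Loss and gain after division by the common factor `F A`.
  have hgap : 0 < p₀ * (1 - Real.exp (-(κ * (c * τ * ε ^ 2)))) :=
    mul_pos hp₀ (sub_pos.2 (Real.exp_lt_one_iff.2 (by simp only [neg_lt_zero]; positivity)))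
  have hlim : Tendsto (fun β : ℝ => p₁ * Real.exp (-(κ * (4 * c * τ * ξ ^ 2 * β ^ 2)))) atTop
      (𝓝 0) := by
    have h1 : Tendsto (fun β : ℝ => κ * (4 * c * τ * ξ ^ 2 * β ^ 2)) atTop atTop :=
      ((tendsto_pow_atTop two_ne_zero).const_mul_atTop (by positivity)).const_mul_atTop hκ₀
    simpa using (Real.tendsto_exp_neg_atTop_nhds_zero.comp h1).const_mul p₁
  filter_upwards [hlim.eventually_lt_const hgap] with β hβ γ hγ
  rw [errorProb_eq hη hNt hτ.le hξ₀.le hξ₁ hν, errorProb_eq hη hNt hτ.le hξ₀.le hξ₁ hν, ← hc]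
  set A := c * meanPhotons τ ξ ν (-β) (ξ * β) with hA
  have hm := meanPhotons_nonneg hτ.le hξ₀.le hξ₁ hν
  have hA₀ : 0 ≤ A := mul_nonneg hc₀.le (hm _ _)
  have e1 : c * meanPhotons τ ξ ν β (ξ * β) = A + 4 * c * τ * ξ ^ 2 * β ^ 2 := by
    rw [hA, meanPhotons, meanPhotons]; ring
  have e2 : c * meanPhotons τ ξ ν (-β) γ = A + c * τ * (γ - ξ * β) ^ 2 := by
    rw [hA, meanPhotons, meanPhotons]; ring
  have hF := photonCdf_pos ha N hA₀
  have hF₁ := (photonCdf_pos ha N (mul_nonneg hc₀.le (hm β γ))).le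
  have b1 := photonCdf_add_le ha N hA₀
    (show 0 ≤ 4 * c * τ * ξ ^ 2 * β ^ 2 by positivity)
  have b2 := photonCdf_add_le ha N hA₀
    (show 0 ≤ c * τ * (γ - ξ * β) ^ 2 by positivity)
  have hsq : ε ^ 2 ≤ (γ - ξ * β) ^ 2 := by
    rw [← sq_abs (γ - ξ * β)]
    exact pow_le_pow_left₀ hε.le hγ 2
  have b3 : Real.exp (-(κ * (c * τ * (γ - ξ * β) ^ 2))) ≤ Real.exp (-(κ * (c * τ * ε ^ 2))) := by
    gcongr
  rw [← hκ] at b1 b2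
  rw [e1, e2]
  have b4 := mul_le_mul_of_nonneg_left b1 hp₁
  have b5 := mul_le_mul_of_nonneg_left (b2.trans (mul_le_mul_of_nonneg_right b3 hF.le)) hp₀.le
  have b6 := mul_lt_mul_of_pos_right hβ hF
  have b7 := mul_nonneg hp₁ hF₁
  linarith

end Optimum

end KennedyReceiver

theorem theorem2 (p₀ p₁ η Nt τ ξ ν : ℝ)
    (hp₀ : 0 < p₀) (hp₁ : 0 ≤ p₁) (hp : p₀ + p₁ = 1)
    (hη₀ : 0 < η) (hη₁ : η ≤ 1) (hNt : 0 < Nt)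
    (hτ₀ : 0 < τ) (hτ₁ : τ ≤ 1) (hξ₀ : 0 < ξ) (hξ₁ : ξ ≤ 1) (hν : 0 ≤ ν) (Kth : ℕ) :
    (∀ᶠ β : ℝ in atTop,
      ∃ γ : ℝ, KennedyReceiver.IsOptimumDisplacement p₀ p₁ η Nt τ ξ ν β Kth γ) ∧
    ∀ γopt : ℝ → ℝ,
      (∀ᶠ β : ℝ in atTop,
        KennedyReceiver.IsOptimumDisplacement p₀ p₁ η Nt τ ξ ν β Kth (γopt β)) →
      Tendsto (fun β : ℝ => γopt β - ξ * β) atTop (𝓝 0) := by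
  have key := fun {ε : ℝ} => KennedyReceiver.eventually_errorProb_lt (ε := ε)
    hp₀ hp₁ hη₀ hNt hτ₀ hξ₀ hξ₁ hν Kth
  refine ⟨?_, fun γopt hopt => ?_⟩
  · filter_upwards [key one_pos] with β hβ
    have hcont := KennedyReceiver.continuous_errorProb hη₀ hNt hτ₀.le hξ₀.le hξ₁ hν p₀ p₁ β Kth
    -- Outside this ball the error exceeds its value at the centre, so a minimum over the ball is
    -- global.
    obtain ⟨γ, -, hmin⟩ := (isCompact_closedBall (ξ * β) 1).exists_isMinOn
      ⟨ξ * β, Metric.mem_closedBall_self zero_le_one⟩ hcont.continuousOn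
    refine ⟨γ, fun γ' => ?_⟩
    rcases le_total (|γ' - ξ * β|) 1 with h | h
    · exact hmin (Metric.mem_closedBall.2 (by rwa [Real.dist_eq]))
    · exact (hmin (Metric.mem_closedBall_self zero_le_one)).trans (hβ γ' h).le
  · rw [Metric.tendsto_nhds]
    intro ε hε
    filter_upwards [key hε, hopt] with β hβ hmin
    rw [Real.dist_eq, sub_zero]
    by_contra! h
    exact (hβ _ h).not_ge (hmin _)
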